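/- Let $p$ be a prime number. A pro-$p$ group $G$ is called a *($p$-)Demuškin group* if $\dim_{\mathbb F_p}H^1(G,\mathbb Z/p)<\infty$, $\dim_{\mathbb F_p}H^2(G,\mathbb Z/p)=1$ and the cup product $H^1(G,\mathbb Z/p)\times H^1(G,\mathbb Z/p)\to H^2(G,\mathbb Z/p)$ is non-degenerate; its *rank* is $\dim_{\mathbb F_p}H^1(G,\mathbb Z/p)$. Its dualizing module is $$I=\varinjlim_m\varinjlim_U H^2(U,\mathbb Z/p^m)^*,\qquad (\cdot)^*=\mathrm{Hom}(\cdot,\mathbb Q/\mathbb Z),$$ where $U$ runs through the open normal subgroups of $G$ and the transition maps are dual to the corestrictions and to the reductions $\mathbb Z/p^{m+1}\to\mathbb Z/p^m$; the group $G$ acts on $I$, and the *invariant* of $G$ is $q=\#(I^G)$. (Cohomology is continuous cohomology with trivial action on the coefficients.) **Proposition 2.1.** Let $G$ be a $p$-Demuškin group of rank $n+2$, $n\ge 0$, with finite invariant $q>2$, and let $F$ be a free quotient of $G$, i.e. a free pro-$p$ group with a continuous surjective homomorphism $G\to F$. Then the inflation map $H^1(F,\mathbb Z/q)\to H^1(G,\mathbb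 Z/q)$ is injective, and, regarding $H^1(F,\mathbb Z/q)$ as a submodule of $H^1(G,\mathbb Z/q)$ through it: 1. $H^1(F,\mathbb Z/q)$ lies in the kernel of the Bockstein homomorphism $B:H^1(G,\mathbb Z/q)\to H^2(G,\mathbb Z/q)$, the connecting homomorphism of $0\to\mathbb Z/q\xrightarrow{\,q\,}\mathbb Z/q^2\to\mathbb Z/q\to 0$; 2. $H^1(F,\mathbb Z/q)$ is a free $\mathbb Z/q$-submodule of $H^1(G,\mathbb Z/q)$, and it is totally isotropic for the cup product $H^1(G,\mathbb Z/q)\times H^1(G,\mathbb Z/q)\to H^2(G,\mathbb Z/q)$. In particular, the rank of $F$ (the cardinality of a basis of the free pro-$p$ group $F$) is finite and $$\operatorname{rank}F\le \frac n2+1 .$$ -/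

import Mathlib

noncomputable section

namespace Demushkin

universe u v w

/-! ### Cohomology with trivial coefficients, in degrees one and two

A topological group `G` acts trivially on a discrete commutative ring `R`. The cohomology of `G` is
that of the complex of inhomogeneous continuous cochains; a continuous map to a discrete space is
the same thing as a locally constant map. -/

section Cochains

variable (G : Type u) [Group G] [TopologicalSpace G] [IsTopologicalGroup G]
variable (R : Type w) [CommRing R]

/-- The coboundary of a continuous `1`-cochain: `(d f)(x, y) = f x - f (x y) + f y`. -/
def dOne : LocallyConstant G R →ₗ[R] LocallyConstant (G × G) R :=
  LocallyConstant.comapₗ R ⟨fun x => x.1, by fun_prop⟩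
    - LocallyConstant.comapₗ R ⟨fun x => x.1 * x.2, by fun_prop⟩
    + LocallyConstant.comapₗ R ⟨fun x => x.2, by fun_prop⟩

/-- The coboundary of a continuous `2`-cochain:
`(d c)(x, y, z) = c (y, z) - c (x y, z) + c (x, y z) - c (x, y)`. -/
def dTwo : LocallyConstant (G × G) R →ₗ[R] LocallyConstant (G × G × G) R :=
  LocallyConstant.comapₗ R ⟨fun x => (x.2.1, x.2.2), by fun_prop⟩
    - LocallyConstant.comapₗ R ⟨fun x => (x.1 * x.2.1, x.2.2), by fun_prop⟩
    + LocallyConstant.comapₗ R ⟨fun x => (x.1, x.2.1 * x.2.2), by fun_prop⟩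
    - LocallyConstant.comapₗ R ⟨fun x => (x.1, x.2.1), by fun_prop⟩

variable {G R}

@[simp] lemma dOne_apply (f : LocallyConstant G R) (x y : G) :
    dOne G R f (x, y) = f x - f (x * y) + f y := rfl

@[simp] lemma dTwo_apply (c : LocallyConstant (G × G) R) (x y z : G) :
    dTwo G R c (x, y, z) = c (y, z) - c (x * y, z) + c (x, y * z) - c (x, y) := rfl

variable (G R)

/-- `H¹(G, R)`: since the action is trivial, the coboundary of a `0`-cochain is zero, and `H¹` is
the module of continuous `1`-cocycles, i.e. of continuous homomorphisms `G → R`. -/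
abbrev H1 : Type (max u w) := LinearMap.ker (dOne G R)

/-- `H²(G, R)`: continuous `2`-cocycles modulo coboundaries of continuous `1`-cochains. -/
abbrev H2 : Type (max u w) :=
  LinearMap.ker (dTwo G R) ⧸ (LinearMap.range (dOne G R)).submoduleOf (LinearMap.ker (dTwo G R))

variable {G R}

lemma H1.map_mul (a : H1 G R) (x y : G) : a.1 (x * y) = a.1 x + a.1 y := by
  have h : dOne G R a.1 (x, y) = 0 := by rw [LinearMap.mem_ker.1 a.2]; rfl
  rw [dOne_apply] at h
  linear_combination -h

lemma mem_ker_dTwo {c : LocallyConstant (G × G) R} :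
    c ∈ LinearMap.ker (dTwo G R) ↔
      ∀ x y z, c (y, z) - c (x * y, z) + c (x, y * z) - c (x, y) = 0 := by
  rw [LinearMap.mem_ker]
  constructor
  · intro h x y z
    rw [← dTwo_apply, h]; rfl
  · intro h
    ext ⟨x, y, z⟩
    exact h x y z

/-- The cohomology class of a `2`-cocycle. -/
def H2.mk (c : LocallyConstant (G × G) R) (hc : c ∈ LinearMap.ker (dTwo G R)) : H2 G R :=
  Submodule.Quotient.mk ⟨c, hc⟩

lemma H2.mk_eq_mk {c c' : LocallyConstant (G × G) R} {hc : c ∈ LinearMap.ker (dTwo G R)}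
    {hc' : c' ∈ LinearMap.ker (dTwo G R)} (f : LocallyConstant G R)
    (hf : ∀ x y, f x - f (x * y) + f y = c (x, y) - c' (x, y)) :
    H2.mk c hc = H2.mk c' hc' := by
  refine (Submodule.Quotient.eq _).2 ⟨f, ?_⟩
  ext ⟨x, y⟩
  exact hf x y

/-- The cochain `(x, y) ↦ a x * b y`. -/
def cupCochain (a b : LocallyConstant G R) : LocallyConstant (G × G) R :=
  a.comap ⟨fun x => x.1, by fun_prop⟩ * b.comap ⟨fun x => x.2, by fun_prop⟩

lemma cupCochain_mem (a b : H1 G R) : cupCochain a.1 b.1 ∈ LinearMap.ker (dTwo G R) := by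
  refine mem_ker_dTwo.2 fun x y z => ?_
  change a.1 y * b.1 z - a.1 (x * y) * b.1 z + a.1 x * b.1 (y * z) - a.1 x * b.1 y = 0
  rw [H1.map_mul, H1.map_mul]; ring

variable (G R)

/-- The cup product `H¹(G, R) × H¹(G, R) → H²(G, R)`, the class of `(x, y) ↦ a x * b y`. -/
def cup : H1 G R →ₗ[R] H1 G R →ₗ[R] H2 G R :=
  LinearMap.mk₂ R (fun a b => H2.mk (cupCochain a.1 b.1) (cupCochain_mem a b))
    (fun _ _ _ => congrArg Submodule.Quotient.mk
      (Subtype.ext (LocallyConstant.ext fun _ => add_mul _ _ _)))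
    (fun _ _ _ => congrArg Submodule.Quotient.mk
      (Subtype.ext (LocallyConstant.ext fun _ => mul_assoc _ _ _)))
    (fun _ _ _ => congrArg Submodule.Quotient.mk
      (Subtype.ext (LocallyConstant.ext fun _ => mul_add _ _ _)))
    (fun _ _ _ => congrArg Submodule.Quotient.mk
      (Subtype.ext (LocallyConstant.ext fun _ => mul_left_comm _ _ _)))

variable {G}

/-- The inflation map `H¹(F, R) → H¹(G, R)` along a continuous homomorphism `π : G → F`. -/
def inflation {F : Type v} [Group F] [TopologicalSpace F] [IsTopologicalGroup F] (π : G →ₜ* F) :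
    H1 F R →ₗ[R] H1 G R :=
  (LocallyConstant.comapₗ R (π : C(G, F))).restrict fun f hf => by
    rw [LinearMap.mem_ker]
    ext ⟨x, y⟩
    change f (π x) - f (π (x * y)) + f (π y) = 0
    rw [map_mul, H1.map_mul (⟨f, hf⟩ : H1 F R)]; ring

end Cochains

/-! ### The Bockstein homomorphism -/

section Bockstein

variable (G : Type u) [Group G] [TopologicalSpace G] [IsTopologicalGroup G]
variable (q : ℕ) [NeZero q]

/-- Lift `f : G → ℤ/q` to integers (hence to `ℤ/q²`), take the coboundary
`f x - f (x y) + f y` of the lift, and divide it by `q`. -/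
def bocksteinCochain {G : Type u} [Group G] [TopologicalSpace G] [IsTopologicalGroup G] {q : ℕ}
    (f : LocallyConstant G (ZMod q)) : LocallyConstant (G × G) (ZMod q) :=
  (dOne G ℤ (f.map fun a => (a.val : ℤ))).map fun k => ((k / (q : ℤ) : ℤ) : ZMod q)

variable {G q}

lemma carry_spec (a b : ZMod q) :
    (q : ℤ) * (((a.val : ℤ) - ((a + b).val : ℤ) + (b.val : ℤ)) / (q : ℤ))
      = (a.val : ℤ) - ((a + b).val : ℤ) + (b.val : ℤ) := by
  refine Int.mul_ediv_cancel' ?_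
  rw [← ZMod.intCast_zmod_eq_zero_iff_dvd]
  push_cast
  simp

/-- The integer cochain whose reduction is the Bockstein cochain of a cocycle. -/
lemma bocksteinCochain_spec (f : H1 G (ZMod q)) (x y : G) :
    ∃ k : ℤ, bocksteinCochain f.1 (x, y) = (k : ZMod q) ∧
      (q : ℤ) * k = ((f.1 x).val : ℤ) - ((f.1 (x * y)).val : ℤ) + ((f.1 y).val : ℤ) := by
  refine ⟨_, rfl, ?_⟩
  rw [dOne_apply]
  simp only [LocallyConstant.map_apply, Function.comp_apply]
  rw [H1.map_mul]
  exact carry_spec _ _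

lemma bocksteinCochain_mem (f : H1 G (ZMod q)) :
    bocksteinCochain f.1 ∈ LinearMap.ker (dTwo G (ZMod q)) := by
  refine mem_ker_dTwo.2 fun x y z => ?_
  obtain ⟨k₁, h₁, e₁⟩ := bocksteinCochain_spec f y z
  obtain ⟨k₂, h₂, e₂⟩ := bocksteinCochain_spec f (x * y) z
  obtain ⟨k₃, h₃, e₃⟩ := bocksteinCochain_spec f x (y * z)
  obtain ⟨k₄, h₄, e₄⟩ := bocksteinCochain_spec f x y
  rw [h₁, h₂, h₃, h₄]
  have hq : (q : ℤ) ≠ 0 := by exact_mod_cast NeZero.ne q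
  have : k₁ - k₂ + k₃ - k₄ = 0 := by
    apply mul_left_cancel₀ hq
    rw [mul_assoc] at e₂
    linear_combination e₁ - e₂ + e₃ - e₄
  exact_mod_cast congrArg (Int.cast : ℤ → ZMod q) this

lemma bockstein_add (f g : H1 G (ZMod q)) :
    H2.mk (bocksteinCochain (f + g).1) (bocksteinCochain_mem (f + g)) =
      H2.mk (bocksteinCochain f.1) (bocksteinCochain_mem f) +
        H2.mk (bocksteinCochain g.1) (bocksteinCochain_mem g) := by
  let κ : ZMod q → ZMod q → ℤ := fun a b =>
    ((a.val : ℤ) - ((a + b).val : ℤ) + (b.val : ℤ)) / (q : ℤ)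
  let e : LocallyConstant G (ZMod q) :=
    ⟨fun x => ((-κ (f.1 x) (g.1 x) : ℤ) : ZMod q), by
      have h := (f.1.isLocallyConstant.prodMk g.1.isLocallyConstant)
      exact h.comp fun a => ((-κ a.1 a.2 : ℤ) : ZMod q)⟩
  refine (H2.mk_eq_mk (c' := bocksteinCochain f.1 + bocksteinCochain g.1)
    (hc' := Submodule.add_mem _ (bocksteinCochain_mem f) (bocksteinCochain_mem g)) e ?_).trans rfl
  intro x y
  obtain ⟨k₁, h₁, e₁⟩ := bocksteinCochain_spec (f + g) x y
  obtain ⟨k₂, h₂, e₂⟩ := bocksteinCochain_spec f x y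
  obtain ⟨k₃, h₃, e₃⟩ := bocksteinCochain_spec g x y
  rw [LocallyConstant.add_apply, h₁, h₂, h₃]
  have hadd : ∀ t, (f + g).1 t = f.1 t + g.1 t := fun _ => rfl
  rw [hadd, hadd, hadd] at e₁
  have c₁ := carry_spec (f.1 x) (g.1 x)
  have c₂ := carry_spec (f.1 y) (g.1 y)
  have c₃ := carry_spec (f.1 (x * y)) (g.1 (x * y))
  have hq : (q : ℤ) ≠ 0 := by exact_mod_cast NeZero.ne q
  have : -κ (f.1 x) (g.1 x) - -κ (f.1 (x * y)) (g.1 (x * y)) + -κ (f.1 y) (g.1 y)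
      = k₁ - (k₂ + k₃) := by
    apply mul_left_cancel₀ hq
    linear_combination -c₁ - c₂ + c₃ - e₁ + e₂ + e₃
  have h := congrArg (Int.cast : ℤ → ZMod q) this
  rw [Int.cast_add, Int.cast_sub, Int.cast_sub, Int.cast_add] at h
  exact h

variable (G q)

/-- The Bockstein homomorphism `B : H¹(G, ℤ/q) → H²(G, ℤ/q)`, the connecting homomorphism of
`0 → ℤ/q → ℤ/q² → ℤ/q → 0`, the first map being multiplication by `q`. -/
def bockstein : H1 G (ZMod q) →ₗ[ZMod q] H2 G (ZMod q) :=
  { toFun := fun f => H2.mk (bocksteinCochain f.1) (bocksteinCochain_mem f)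
    map_add' := bockstein_add
    map_smul' := fun c f => ZMod.map_smul (AddMonoidHom.mk' (fun f : H1 G (ZMod q) =>
      H2.mk (bocksteinCochain f.1) (bocksteinCochain_mem f)) bockstein_add) c f }

end Bockstein

/-! ### Homogeneous cochains and the dualizing module

For a closed subgroup `U` of a profinite group `G`, the cohomology of `U` with values in a discrete
trivial module `A` is also that of the complex of `U`-invariant homogeneous continuous cochains
`G^(n+1) → A`. In this description the action of `G` and the corestriction are given by translation
and by the norm. -/

section Dualizing

variable {G : Type u} [Group G] [TopologicalSpace G] [IsTopologicalGroup G]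
variable {A : Type v} [AddCommGroup A] {B : Type w} [AddCommGroup B]

variable (G A) in
/-- Homogeneous continuous `n`-cochains of `G` with values in `A`. -/
abbrev Cochain (n : ℕ) : Type (max u v) := LocallyConstant (Fin (n + 1) → G) A

/-- `(g • f)(x₀, …, xₙ) = f (g⁻¹ x₀, …, g⁻¹ xₙ)`. -/
def translate (n : ℕ) (g : G) : Cochain G A n →+ Cochain G A n :=
  LocallyConstant.comapAddMonoidHom ⟨fun x i => g⁻¹ * x i, by fun_prop⟩

/-- `(d f)(x₀, …, xₙ₊₁) = ∑ i, (-1)^i f (x₀, …, x̂ᵢ, …, xₙ₊₁)`. -/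
def hd (n : ℕ) : Cochain G A n →+ Cochain G A (n + 1) :=
  ∑ i : Fin (n + 2), (-1 : ℤ) ^ (i : ℕ) •
    (LocallyConstant.comapAddMonoidHom (⟨fun x j => x (i.succAbove j), by fun_prop⟩ :
      C(Fin (n + 2) → G, Fin (n + 1) → G)) : Cochain G A n →+ Cochain G A (n + 1))

variable (A) in
/-- The homogeneous `n`-cochains which are invariant under `U`. -/
def invCochains (U : Subgroup G) (n : ℕ) : AddSubgroup (Cochain G A n) where
  carrier := {f | ∀ g ∈ U, translate n g f = f}
  add_mem' hf hf' g hg := by rw [map_add, hf g hg, hf' g hg]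
  zero_mem' g _ := map_zero _
  neg_mem' hf g hg := by rw [map_neg, hf g hg]

lemma mem_invCochains {U : Subgroup G} {n : ℕ} {f : Cochain G A n} :
    f ∈ invCochains A U n ↔ ∀ g ∈ U, translate n g f = f := Iff.rfl

variable (A) in
/-- `U`-invariant homogeneous `2`-cocycles. -/
def cocyclesTwo (U : Subgroup G) : AddSubgroup (Cochain G A 2) :=
  invCochains A U 2 ⊓ (hd 2).ker

variable (A) in
/-- Coboundaries of `U`-invariant homogeneous `1`-cochains. -/
def coboundariesTwo (U : Subgroup G) : AddSubgroup (Cochain G A 2) :=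
  (invCochains A U 1).map (hd 1)

variable (A) in
/-- The cohomology group `H²(U, A)` of a closed subgroup `U` of `G`. -/
abbrev SubgroupH2 (U : Subgroup G) : Type (max u v) :=
  cocyclesTwo A U ⧸ (coboundariesTwo A U).addSubgroupOf (cocyclesTwo A U)

/-- A map of cochains that commutes with the coboundary and takes `V`-invariants to `U`-invariants
induces a map `H²(V, A) → H²(U, B)`. -/
def SubgroupH2.map {V U : Subgroup G} (T : ∀ n, Cochain G A n →+ Cochain G B n)
    (hT : ∀ n f, hd n (T n f) = T (n + 1) (hd n f))
    (hinv : ∀ n, ∀ f ∈ invCochains A V n, T n f ∈ invCochains B U n) :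
    SubgroupH2 A V →+ SubgroupH2 B U :=
  QuotientAddGroup.map _ _
    (((T 2).comp (cocyclesTwo A V).subtype).codRestrict (cocyclesTwo B U) fun f =>
      ⟨hinv 2 _ f.2.1, by
        change hd 2 (T 2 f.1) = 0
        rw [hT, show hd 2 f.1 = 0 from f.2.2, map_zero]⟩)
    (by
      rintro f ⟨e, he, hef⟩
      exact ⟨T 1 e, hinv 1 e he, (hT 1 e).trans (congrArg (T 2) hef)⟩)

set_option linter.unusedSectionVars false in
lemma hd_apply (n : ℕ) (f : Cochain G A n) (x : Fin (n + 2) → G) :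
    hd n f x = ∑ i : Fin (n + 2), (-1 : ℤ) ^ (i : ℕ) • f fun j => x (i.succAbove j) := by
  have h : ∀ F : Fin (n + 2) → Cochain G A (n + 1), (∑ i, F i) x = ∑ i, F i x := fun F =>
    map_sum (LocallyConstant.evalAddMonoidHom x : LocallyConstant (Fin (n + 2) → G) A →+ A) F _
  rw [hd, AddMonoidHom.finsetSum_apply, h]
  rfl

lemma translate_apply (n : ℕ) (g : G) (f : Cochain G A n) (x : Fin (n + 1) → G) :
    translate n g f x = f fun i => g⁻¹ * x i := rfl

lemma translate_mul (n : ℕ) (g h : G) (f : Cochain G A n) :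
    translate n (g * h) f = translate n g (translate n h f) := by
  ext x
  simp only [translate_apply, mul_inv_rev, mul_assoc]

lemma hd_translate (n : ℕ) (g : G) (f : Cochain G A n) :
    hd n (translate n g f) = translate (n + 1) g (hd n f) := by
  ext x
  simp only [hd_apply, translate_apply]

lemma translate_mem (U : Subgroup G) [U.Normal] {n : ℕ} (g : G) {f : Cochain G A n}
    (hf : f ∈ invCochains A U n) : translate n g f ∈ invCochains A U n := by
  intro h hh
  rw [← translate_mul, show h * g = g * (g⁻¹ * h * g) by group, translate_mul,
    hf _ (by simpa using Subgroup.Normal.conj_mem ‹U.Normal› h hh g⁻¹)]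

/-- The action of `g ∈ G` on `H²(U, A)`, for `U` normal in `G`. -/
def actH2 (U : Subgroup G) [U.Normal] (g : G) : SubgroupH2 A U →+ SubgroupH2 A U :=
  SubgroupH2.map (fun n => translate n g) (fun n f => hd_translate n g f) fun _ _ hf =>
    translate_mem U g hf

/-- The map `H²(U, A) → H²(U, B)` induced by a homomorphism of coefficients `A → B`. -/
def coeffH2 (U : Subgroup G) (φ : A →+ B) : SubgroupH2 A U →+ SubgroupH2 B U :=
  SubgroupH2.map (fun _ => LocallyConstant.mapAddMonoidHom φ)
    (fun n f => by
      ext x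
      change _ = φ (hd n f x)
      rw [hd_apply, hd_apply, map_sum]
      refine Finset.sum_congr rfl fun i _ => ?_
      rw [map_zsmul]
      rfl)
    fun n f hf => by
      rw [mem_invCochains] at hf ⊢
      intro g hg
      conv_rhs => rw [← hf g hg]
      rfl

lemma coeffH2_actH2 (U : Subgroup G) [U.Normal] (φ : A →+ B) (g : G) (x : SubgroupH2 A U) :
    coeffH2 U φ (actH2 U g x) = actH2 U g (coeffH2 U φ x) := by
  obtain ⟨f, rfl⟩ := QuotientAddGroup.mk_surjective x
  rfl

section Cor

variable [CompactSpace G]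

/-- The finite set of cosets `U / V`, for open subgroups `V` and `U`. -/
instance (U V : OpenNormalSubgroup G) :
    Finite ((U : Subgroup G) ⧸ (V : Subgroup G).subgroupOf (U : Subgroup G)) :=
  Subgroup.quotient_finite_of_isOpen' (U : Subgroup G) _ U.isOpen
    (V.isOpen.preimage continuous_subtype_val)

instance (U V : OpenNormalSubgroup G) :
    Fintype ((U : Subgroup G) ⧸ (V : Subgroup G).subgroupOf (U : Subgroup G)) :=
  Fintype.ofFinite _

/-- The norm `f ↦ ∑ u ∈ U / V, u • f`, through a system of representatives `u`; on `V`-invariant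
cochains it does not depend on the representatives. -/
def normCochain (U V : OpenNormalSubgroup G) (n : ℕ) : Cochain G A n →+ Cochain G A n :=
  ∑ c : (U : Subgroup G) ⧸ (V : Subgroup G).subgroupOf (U : Subgroup G),
    translate n (c.out : G)

lemma normCochain_apply (U V : OpenNormalSubgroup G) (n : ℕ) (f : Cochain G A n) :
    normCochain U V n f =
      ∑ c : (U : Subgroup G) ⧸ (V : Subgroup G).subgroupOf (U : Subgroup G),
        translate n (c.out : G) f := by
  rw [normCochain, AddMonoidHom.finsetSum_apply]

set_option linter.unusedSectionVars false in
lemma translate_out (U V : OpenNormalSubgroup G) {n : ℕ} {f : Cochain G A n}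
    (hf : f ∈ invCochains A (V : Subgroup G) n) (u : (U : Subgroup G)) :
    translate n
      ((u : (U : Subgroup G) ⧸ (V : Subgroup G).subgroupOf (U : Subgroup G)).out : G) f
      = translate n (u : G) f := by
  obtain ⟨v, hv⟩ := QuotientGroup.mk_out_eq_mul ((V : Subgroup G).subgroupOf (U : Subgroup G)) u
  have hv' : (((v : (U : Subgroup G)) : G)) ∈ (V : Subgroup G) := v.2
  rw [hv, Subgroup.coe_mul, translate_mul]
  exact congrArg _ (hf _ hv')

lemma normCochain_mem (U V : OpenNormalSubgroup G) {n : ℕ} {f : Cochain G A n}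
    (hf : f ∈ invCochains A (V : Subgroup G) n) :
    normCochain U V n f ∈ invCochains A (U : Subgroup G) n := by
  intro u hu
  rw [normCochain_apply, map_sum]
  refine Fintype.sum_equiv (MulAction.toPerm (⟨u, hu⟩ : (U : Subgroup G))) _ _ fun c => ?_
  rw [← translate_mul]
  have h := translate_out U V hf (⟨u, hu⟩ * c.out)
  have h2 : ((⟨u, hu⟩ * c.out : (U : Subgroup G)) :
      (U : Subgroup G) ⧸ (V : Subgroup G).subgroupOf (U : Subgroup G)) =
      MulAction.toPerm (⟨u, hu⟩ : (U : Subgroup G)) c := by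
    conv_rhs => rw [← QuotientGroup.out_eq' c]
    rfl
  rw [h2] at h
  exact h.symm

lemma hd_normCochain (U V : OpenNormalSubgroup G) (n : ℕ) (f : Cochain G A n) :
    hd n (normCochain U V n f) = normCochain U V (n + 1) (hd n f) := by
  rw [normCochain_apply, normCochain_apply, map_sum]
  exact Finset.sum_congr rfl fun c _ => hd_translate _ _ _

lemma translate_normCochain (U V : OpenNormalSubgroup G) {n : ℕ} {f : Cochain G A n}
    (hf : f ∈ invCochains A (V : Subgroup G) n) (g : G) :
    translate n g (normCochain U V n f) = normCochain U V n (translate n g f) := by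
  have hgf : translate n g f ∈ invCochains A (V : Subgroup G) n := translate_mem _ g hf
  rw [normCochain_apply, normCochain_apply, map_sum]
  let conj : ↥(U : Subgroup G) → ↥(U : Subgroup G) := fun u =>
    ⟨g * (u : G) * g⁻¹, U.isNormal'.conj_mem _ u.2 g⟩
  let e : (U : Subgroup G) ⧸ (V : Subgroup G).subgroupOf (U : Subgroup G) →
      (U : Subgroup G) ⧸ (V : Subgroup G).subgroupOf (U : Subgroup G) := fun c => conj c.out
  have he : Function.Injective e := by
    intro a b hab
    have h := QuotientGroup.eq.1 hab
    rw [Subgroup.mem_subgroupOf] at h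
    rw [← QuotientGroup.out_eq' a, ← QuotientGroup.out_eq' b]
    refine QuotientGroup.eq.2 ?_
    rw [Subgroup.mem_subgroupOf]
    have h' := V.isNormal'.conj_mem _ h g⁻¹
    convert h' using 1
    simp only [conj, Subgroup.coe_mul, Subgroup.coe_inv]
    group
  refine Fintype.sum_bijective e (Finite.injective_iff_bijective.1 he) _ _ fun c => ?_
  rw [translate_out U V hgf, ← translate_mul, ← translate_mul]
  simp only [conj, inv_mul_cancel_right]

/-- The corestriction `H²(V, A) → H²(U, A)` for open normal subgroups `V ≤ U` of `G`. -/
def cor (U V : OpenNormalSubgroup G) :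
    SubgroupH2 A (V : Subgroup G) →+ SubgroupH2 A (U : Subgroup G) :=
  SubgroupH2.map (normCochain U V) (hd_normCochain U V) fun _ _ hf => normCochain_mem U V hf

lemma cor_actH2 (U V : OpenNormalSubgroup G) (g : G) (x : SubgroupH2 A (V : Subgroup G)) :
    cor U V (actH2 (V : Subgroup G) g x) = actH2 (U : Subgroup G) g (cor U V x) := by
  obtain ⟨f, rfl⟩ := QuotientAddGroup.mk_surjective x
  exact congrArg QuotientAddGroup.mk (Subtype.ext (translate_normCochain U V f.2.1 g).symm)

end Cor

variable (p : ℕ) (G)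

/-- Pairs `(m, U)` of a natural number and an open normal subgroup; `(m, U) ≤ (m', V)` means
`m ≤ m'` and `V ≤ U`. -/
abbrev DualizingIndex : Type u := ℕ × (OpenNormalSubgroup G)ᵒᵈ

variable {G}

/-- The open normal subgroup of an index. -/
abbrev DualizingIndex.group (i : DualizingIndex G) : OpenNormalSubgroup G := OrderDual.ofDual i.2

/-- `H²(U, ℤ/p^m)^* = Hom(H²(U, ℤ/p^m), ℚ/ℤ)`. -/
abbrev DualH2 (i : DualizingIndex G) : Type u :=
  SubgroupH2 (ZMod (p ^ i.1)) (i.group : Subgroup G) →+ AddCircle (1 : ℚ)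

/-- The action of `g ∈ G` on `H²(U, ℤ/p^m)^*`: `(g φ)(c) = φ (g⁻¹ c)`. -/
def actDualH2 (i : DualizingIndex G) (g : G) : DualH2 p i →+ DualH2 p i :=
  AddMonoidHom.compHom' (actH2 (i.group : Subgroup G) g⁻¹)

variable [CompactSpace G]

/-- The map `H²(V, ℤ/p^m') → H²(U, ℤ/p^m)`, corestriction followed by reduction of coefficients. -/
def corRed {i j : DualizingIndex G} (h : i ≤ j) :
    SubgroupH2 (ZMod (p ^ j.1)) (j.group : Subgroup G) →+
      SubgroupH2 (ZMod (p ^ i.1)) (i.group : Subgroup G) :=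
  (coeffH2 (i.group : Subgroup G)
    (ZMod.castHom (pow_dvd_pow p h.1) (ZMod (p ^ i.1))).toAddMonoidHom).comp (cor i.group j.group)

/-- The transition map `H²(U, ℤ/p^m)^* → H²(V, ℤ/p^m')^*`. -/
def dualTransition (i j : DualizingIndex G) (h : i ≤ j) : DualH2 p i →+ DualH2 p j :=
  AddMonoidHom.compHom' (corRed p h)

variable (G)

open Classical in
/-- The dualizing module `I = lim_m lim_U H²(U, ℤ/p^m)^*`, a direct limit over `m` and over the open
normal subgroups `U` of `G`. -/
abbrev DualizingModule : Type u :=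
  AddCommGroup.DirectLimit (fun i : DualizingIndex G => DualH2 p i) (dualTransition p)

variable {G}

open Classical in
/-- The action of `g ∈ G` on the dualizing module. -/
def dualizingAct (g : G) : DualizingModule G p →+ DualizingModule G p :=
  AddCommGroup.DirectLimit.map (fun i => actDualH2 p i g) fun i j h => by
    refine AddMonoidHom.ext fun φ => AddMonoidHom.ext fun x => ?_
    change φ (corRed p h (actH2 _ g⁻¹ x)) = φ (actH2 _ g⁻¹ (corRed p h x))
    rw [corRed, AddMonoidHom.comp_apply, AddMonoidHom.comp_apply, cor_actH2, coeffH2_actH2]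

variable (G)

/-- The group `I^G` of invariants of the dualizing module. -/
def dualizingInvariants : AddSubgroup (DualizingModule G p) where
  carrier := {x | ∀ g : G, dualizingAct p g x = x}
  add_mem' hx hy g := by rw [map_add, hx g, hy g]
  zero_mem' g := map_zero _
  neg_mem' hx g := by rw [map_neg, hx g]

end Dualizing

/-! ### Pro-`p` groups -/

section ProP

open Filter Topology

variable (p : ℕ)

/-- A profinite group is a pro-`p` group if all its finite continuous quotients are `p`-groups. -/
def IsProP (G : Type u) [Group G] [TopologicalSpace G] [IsTopologicalGroup G] [CompactSpace G]
    [TotallyDisconnectedSpace G] : Prop :=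
  ∀ U : OpenNormalSubgroup G, IsPGroup p (G ⧸ (U : Subgroup G))

/-- `F` is a free pro-`p` group with basis `ι : X → F`: the map `ι` converges to `1` (every
neighbourhood of `1` contains `ι x` for almost all `x`), and every map from `X` to a pro-`p` group
that converges to `1` extends uniquely to a continuous homomorphism. -/
structure IsFreeProP (F : Type u) [Group F] [TopologicalSpace F] [IsTopologicalGroup F]
    [CompactSpace F] [TotallyDisconnectedSpace F] {X : Type v} (ι : X → F) : Prop where
  isProP : IsProP p F
  tendsto : Tendsto ι cofinite (𝓝 1)
  existsUnique_extension : ∀ (H : Type u) [Group H] [TopologicalSpace H] [IsTopologicalGroup H]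
    [CompactSpace H] [TotallyDisconnectedSpace H], IsProP p H →
    ∀ f : X → H, Tendsto f cofinite (𝓝 1) → ∃! ψ : F →ₜ* H, ∀ x, ψ (ι x) = f x

/-- `G` is a `p`-Demuškin group: a pro-`p` group with `H¹(G, 𝔽_p)` finite, `H²(G, 𝔽_p)` of
dimension one, and nondegenerate cup product `H¹ × H¹ → H²`. -/
structure IsDemushkin [Fact p.Prime] (G : Type u) [Group G] [TopologicalSpace G]
    [IsTopologicalGroup G] [CompactSpace G] [TotallyDisconnectedSpace G] : Prop where
  isProP : IsProP p G
  finite_H1 : Module.Finite (ZMod p) (H1 G (ZMod p))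
  finrank_H2 : Module.finrank (ZMod p) (H2 G (ZMod p)) = 1
  nondegenerate : (cup G (ZMod p)).Nondegenerate

/-- The rank of a pro-`p` group `G`, the dimension of `H¹(G, 𝔽_p)` (when that is finite). -/
def proPRank [Fact p.Prime] (G : Type u) [Group G] [TopologicalSpace G]
    [IsTopologicalGroup G] : ℕ :=
  Module.finrank (ZMod p) (H1 G (ZMod p))

end ProP

end Demushkin

end

noncomputable section

namespace Demushkin

universe u v w

open Filter Topology

/-! A free pro-`p` group `F` has no cohomology in degree two with values in a finite `p`-primary
ring `R`: a `2`-cocycle defines a central extension of `F` by `R`, which is again pro-`p`, and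
freeness lifts the basis to a continuous section whose `R`-coordinate is a primitive of the cocycle
(`IsFreeProP.existsUnique_primitive`). Cup products and Bocksteins of inflated classes are
represented by inflated cocycles, so they vanish. Applied to the zero cocycle, the same statement
identifies `H¹(F, R)` with the finitely supported functions on the basis, which gives freeness.

These facts apply to `R = ℤ/q` because `q` is a power of `p`: the dualizing module is `p`-primary
torsion, so its finite group of invariants is a `p`-group.

The rank bound is obtained over `𝔽_p`, where the cup product is nondegenerate by assumption: `H¹(F,
𝔽_p)` is totally isotropic in a space of dimension `n + 2`, hence has dimension at most half of
that, and its dimension is the cardinality of the basis. -/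

lemma H1.finite_support_comp {F : Type u} [Group F] [TopologicalSpace F] [IsTopologicalGroup F]
    {R : Type w} [CommRing R] (f : H1 F R) {X : Type v} {ι : X → F}
    (hι : Tendsto ι cofinite (𝓝 1)) : (Function.support fun x => f.1 (ι x)).Finite := by
  have h1 : f.1 1 = 0 := by simpa using f.map_mul 1 1
  -- Being locally constant, `f` vanishes on a whole neighbourhood of `1`, which contains almost all
  -- `ι x`.
  have h2 : ∀ᶠ y in 𝓝 (1 : F), f.1 y = f.1 1 :=
    (IsLocallyConstant.iff_eventually_eq _).1 f.1.isLocallyConstant 1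
  have h3 : ∀ᶠ x in cofinite, f.1 (ι x) = 0 := by
    filter_upwards [hι.eventually h2] with x hx
    rw [hx, h1]
  exact h3

/-! ### Central extensions attached to continuous `2`-cocycles -/

section CentralExtension

variable {F : Type u} [Group F] [TopologicalSpace F] [IsTopologicalGroup F]
variable {R : Type} [CommRing R]

lemma cocycle_one_left {c : LocallyConstant (F × F) R} (hc : c ∈ LinearMap.ker (dTwo F R))
    (y : F) : c (1, y) = c (1, 1) := by
  have h := mem_ker_dTwo.1 hc 1 1 y
  simp only [one_mul] at h
  linear_combination h

/-- The central extension of `F` by `R` given by a continuous `2`-cocycle. -/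
def CentralExtension (_c : LinearMap.ker (dTwo F R)) : Type u := R × F

namespace CentralExtension

variable (c : LinearMap.ker (dTwo F R))

instance [TopologicalSpace R] : TopologicalSpace (CentralExtension c) :=
  inferInstanceAs (TopologicalSpace (R × F))

instance [TopologicalSpace R] [CompactSpace F] [Finite R] : CompactSpace (CentralExtension c) :=
  inferInstanceAs (CompactSpace (R × F))

instance [TopologicalSpace R] [DiscreteTopology R] [TotallyDisconnectedSpace F] :
    TotallyDisconnectedSpace (CentralExtension c) :=
  inferInstanceAs (TotallyDisconnectedSpace (R × F))

instance : Mul (CentralExtension c) := ⟨fun a b => (a.1 + b.1 + c.1 (a.2, b.2), a.2 * b.2)⟩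

/-- The cocycle is not assumed normalized, so the unit has first coordinate `-c (1, 1)`; this shift
recurs in `incl` and in the values prescribed on a basis. -/
instance : One (CentralExtension c) := ⟨(-c.1 (1, 1), 1)⟩

instance : Inv (CentralExtension c) := ⟨fun a => (-a.1 - c.1 (a.2⁻¹, a.2) - c.1 (1, 1), a.2⁻¹)⟩

instance : Group (CentralExtension c) :=
  Group.ofLeftAxioms
    (by
      rintro ⟨a, x⟩ ⟨b, y⟩ ⟨d, z⟩
      refine Prod.ext ?_ (mul_assoc x y z)
      change a + b + c.1 (x, y) + d + c.1 (x * y, z) = a + (b + d + c.1 (y, z)) + c.1 (x, y * z)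
      linear_combination -(mem_ker_dTwo.1 c.2 x y z))
    (by
      rintro ⟨a, x⟩
      refine Prod.ext ?_ (one_mul x)
      change -c.1 (1, 1) + a + c.1 (1, x) = a
      rw [cocycle_one_left c.2 x]; ring)
    (by
      rintro ⟨a, x⟩
      refine Prod.ext ?_ (inv_mul_cancel x)
      change -a - c.1 (x⁻¹, x) - c.1 (1, 1) + a + c.1 (x⁻¹, x) = -c.1 (1, 1)
      abel)

instance [TopologicalSpace R] [DiscreteTopology R] : IsTopologicalGroup (CentralExtension c) where
  continuous_mul := by
    have hc : Continuous c.1 := c.1.continuous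
    change Continuous fun a : (R × F) × (R × F) =>
      ((a.1.1 + a.2.1 + c.1 (a.1.2, a.2.2), a.1.2 * a.2.2) : R × F)
    fun_prop
  continuous_inv := by
    have hc : Continuous c.1 := c.1.continuous
    change Continuous fun a : R × F => ((-a.1 - c.1 (a.2⁻¹, a.2) - c.1 (1, 1), a.2⁻¹) : R × F)
    fun_prop

/-- The projection of the extension onto `F`. -/
def proj [TopologicalSpace R] : CentralExtension c →ₜ* F where
  toFun a := a.2
  map_one' := rfl
  map_mul' _ _ := rfl
  continuous_toFun := continuous_snd

/-- The inclusion of `R` in the extension. -/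
def incl : Multiplicative R →* CentralExtension c where
  toFun a := (a.toAdd - c.1 (1, 1), 1)
  map_one' := Prod.ext (zero_sub _) rfl
  map_mul' a b := by
    refine Prod.ext ?_ (one_mul (1 : F)).symm
    change a.toAdd + b.toAdd - c.1 (1, 1) =
      a.toAdd - c.1 (1, 1) + (b.toAdd - c.1 (1, 1)) + c.1 (1, 1)
    ring

variable {c}

lemma eq_incl [TopologicalSpace R] {a : CentralExtension c} (h : proj c a = 1) :
    a = incl c (.ofAdd (a.1 + c.1 (1, 1))) :=
  Prod.ext (add_sub_cancel_right _ _).symm h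

/-- An extension of a pro-`p` group by a finite `p`-group is pro-`p`: modulo `U`, some `p^k`-th
power of any element comes from the kernel `R`, and a further `p^m`-th power kills it. -/
lemma isProP [TopologicalSpace R] [DiscreteTopology R] [CompactSpace F]
    [TotallyDisconnectedSpace F] [Finite R] {p : ℕ}
    (hF : IsProP p F) (hR : IsPGroup p (Multiplicative R)) : IsProP p (CentralExtension c) := by
  intro U e
  obtain ⟨e, rfl⟩ := QuotientGroup.mk_surjective e
  have hs : Function.Surjective (proj c : CentralExtension c →* F) := fun x => ⟨(0, x), rfl⟩
  -- The image of `U` in `F` is open because a product projection is an open map.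
  let V : OpenNormalSubgroup F :=
    { toSubgroup := (U : Subgroup (CentralExtension c)).map (proj c : CentralExtension c →* F)
      isOpen' := isOpenMap_snd _ U.isOpen
      isNormal' := U.isNormal'.map _ hs }
  have : (V : Subgroup F).Normal := V.isNormal'
  obtain ⟨k, hk⟩ := hF V (proj c e : F)
  rw [← QuotientGroup.mk_pow, QuotientGroup.eq_one_iff, ← map_pow] at hk
  obtain ⟨t, ht, hte⟩ := hk
  have h1 : proj c (t⁻¹ * e ^ p ^ k) = 1 := by
    rw [map_mul, map_inv, inv_mul_eq_one]; exact hte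
  -- With `t ∈ U` over the same point of `F` as `e ^ p ^ k`, the quotient `t⁻¹ * e ^ p ^ k` lies in
  -- the copy of `R` and has the same class modulo `U` as `e ^ p ^ k`.
  obtain ⟨m, hm⟩ := hR (.ofAdd ((t⁻¹ * e ^ p ^ k).1 + c.1 (1, 1)))
  refine ⟨k + m, ?_⟩
  have h2 : ((t⁻¹ * e ^ p ^ k : CentralExtension c) :
      CentralExtension c ⧸ (U : Subgroup (CentralExtension c))) = (e : _ ⧸ _) ^ p ^ k := by
    rw [QuotientGroup.mk_mul, QuotientGroup.mk_inv, (QuotientGroup.eq_one_iff t).2 ht,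
      QuotientGroup.mk_pow, inv_one, one_mul]
  rw [pow_add, pow_mul, ← h2, ← QuotientGroup.mk_pow, eq_incl h1, ← map_pow, hm, map_one]
  rfl

end CentralExtension

/-! ### Free pro-`p` groups: vanishing of `H²` and computation of `H¹` -/

variable [TopologicalSpace R] [DiscreteTopology R]
variable [CompactSpace F] [TotallyDisconnectedSpace F] [Finite R]

/-- A `2`-cocycle on a free pro-`p` group is the coboundary of a unique cochain with prescribed
values on the basis. -/
theorem IsFreeProP.existsUnique_primitive {X : Type v} {ι : X → F} {p : ℕ}
    (hF : IsFreeProP p F ι) (hR : IsPGroup p (Multiplicative R))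
    (c : LinearMap.ker (dTwo F R)) (s : X →₀ R) :
    ∃! e : LocallyConstant F R,
      (∀ x y, e (x * y) = e x + e y + c.1 (x, y)) ∧ ∀ x, e (ι x) = s x - c.1 (1, 1) := by
  -- The shift by `c (1, 1)` makes the `R`-coordinate that of the unit outside the support of `s`,
  -- so `f` converges to `1`.
  let f : X → CentralExtension c := fun x => (s x - c.1 (1, 1), ι x)
  have hf : Tendsto f cofinite (𝓝 1) := by
    refine Tendsto.prodMk_nhds (tendsto_nhds_of_eventually_eq ?_) hF.tendsto
    filter_upwards [s.hasFiniteSupport.compl_mem_cofinite] with x hx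
    rw [Function.notMem_support.1 hx, zero_sub]
  -- Since `R : Type`, the extension lies in the universe of `F`, as the universal property
  -- requires.
  obtain ⟨ψ, hψ, huniq⟩ := hF.existsUnique_extension _
    (CentralExtension.isProP (c := c) hF.isProP hR) f hf
  -- Both `proj ∘ ψ` and the identity extend `ι`, so uniqueness makes `ψ` a section.
  have hsec : ∀ x, (ψ x).2 = x := by
    obtain ⟨_, _, h⟩ := hF.existsUnique_extension F hF.isProP ι hF.tendsto
    have h1 := h ((CentralExtension.proj c).comp ψ) fun x => congrArg Prod.snd (hψ x)
    have h2 := h (ContinuousMonoidHom.id F) fun _ => rfl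
    exact fun x => DFunLike.congr_fun (h1.trans h2.symm) x
  have hcont : Continuous fun x => (ψ x).1 :=
    continuous_fst.comp (show Continuous (fun x => (ψ x : R × F)) from ψ.continuous_toFun)
  refine ⟨⟨fun x => (ψ x).1, (IsLocallyConstant.iff_continuous _).2 hcont⟩, ⟨fun x y => ?_,
    fun x => congrArg Prod.fst (hψ x)⟩, ?_⟩
  · change (ψ (x * y)).1 = (ψ x).1 + (ψ y).1 + c.1 (x, y)
    rw [map_mul]
    change (ψ x).1 + (ψ y).1 + c.1 ((ψ x).2, (ψ y).2) = _
    rw [hsec, hsec]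
  · rintro e ⟨he, hes⟩
    -- Conversely, any primitive is the `R`-coordinate of a continuous section, so uniqueness of `ψ`
    -- gives uniqueness of the primitive.
    let χ : F →ₜ* CentralExtension c :=
      { toFun := fun x => (e x, x)
        map_one' := by
          refine Prod.ext ?_ rfl
          have h := he 1 1
          rw [mul_one] at h
          change e 1 = -c.1 (1, 1)
          linear_combination -h
        map_mul' := fun x y => Prod.ext (he x y) rfl
        continuous_toFun := e.continuous.prodMk continuous_id }
    have h := huniq χ fun x => Prod.ext (hes x) rfl
    ext x
    exact congrArg Prod.fst (DFunLike.congr_fun h x)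

/-- Inflation from a free pro-`p` group kills classes of degree two. -/
lemma IsFreeProP.mk_comap_eq_zero {X : Type v} {ι : X → F} {p : ℕ}
    (hF : IsFreeProP p F ι) (hR : IsPGroup p (Multiplicative R))
    {G : Type w} [Group G] [TopologicalSpace G] [IsTopologicalGroup G] (π : G →ₜ* F)
    (c : LinearMap.ker (dTwo F R)) {b : LocallyConstant (G × G) R}
    (hb : b ∈ LinearMap.ker (dTwo G R)) (h : ∀ x y, b (x, y) = c.1 (π x, π y)) :
    H2.mk b hb = 0 := by
  -- Only existence matters here, so the values on the basis are chosen arbitrarily. With the sign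
  -- convention of `dOne`, the cochain bounding `c` is `-e`.
  obtain ⟨e, ⟨he, -⟩, -⟩ := hF.existsUnique_primitive hR c 0
  refine (H2.mk_eq_mk (c' := 0) (hc' := Submodule.zero_mem _)
    (-(e.comap (π : C(G, F)))) fun x y => ?_).trans rfl
  change -e (π x) - -e (π (x * y)) + -e (π y) = b (x, y) - 0
  rw [map_mul, he, h]; ring

/-- `H¹(F, R)` is a free module on the basis of `F`. -/
def IsFreeProP.h1Equiv {X : Type v} {ι : X → F} {p : ℕ}
    (hF : IsFreeProP p F ι) (hR : IsPGroup p (Multiplicative R)) : H1 F R ≃ₗ[R] (X →₀ R) :=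
  LinearEquiv.ofBijective
    { toFun := fun f => Finsupp.ofSupportFinite (fun x => f.1 (ι x))
        (f.finite_support_comp hF.tendsto)
      map_add' := fun _ _ => Finsupp.ext fun _ => rfl
      map_smul' := fun _ _ => Finsupp.ext fun _ => rfl }
    (by
      -- Homomorphisms are the primitives of the zero cocycle: uniqueness gives injectivity,
      -- existence surjectivity.
      have key : ∀ (f : H1 F R) (x y : F), f.1 (x * y) = f.1 x + f.1 y +
          (0 : LinearMap.ker (dTwo F R)).1 (x, y) := fun f x y =>
        (f.map_mul x y).trans (add_zero _).symm
      constructor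
      · intro f g hfg
        have h : ∀ x, f.1 (ι x) = g.1 (ι x) := fun x => DFunLike.congr_fun hfg x
        exact Subtype.ext ((hF.existsUnique_primitive hR 0
          (Finsupp.ofSupportFinite (fun x => g.1 (ι x))
            (g.finite_support_comp hF.tendsto))).unique
          ⟨key f, fun x => (h x).trans (sub_zero _).symm⟩
          ⟨key g, fun x => (sub_zero _).symm⟩)
      · intro s
        obtain ⟨e, ⟨he, hes⟩, -⟩ := hF.existsUnique_primitive hR 0 s
        refine ⟨⟨e, ?_⟩, ?_⟩
        · rw [LinearMap.mem_ker]
          ext ⟨x, y⟩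
          rw [dOne_apply, he]
          change e x - (e x + e y + 0) + e y = 0
          ring
        · ext x
          exact (hes x).trans (sub_zero _))

end CentralExtension

/-! ### Injectivity of inflation, and `q` as a power of `p` -/

lemma inflation_injective (R : Type w) [CommRing R] {G : Type u} [Group G] [TopologicalSpace G]
    [IsTopologicalGroup G] {F : Type v} [Group F] [TopologicalSpace F] [IsTopologicalGroup F]
    (π : G →ₜ* F) (hπ : Function.Surjective π) : Function.Injective (inflation R π) := by
  intro f g h
  refine Subtype.ext (LocallyConstant.ext fun y => ?_)
  obtain ⟨x, rfl⟩ := hπ y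
  exact LocallyConstant.congr_fun (congrArg Subtype.val h) x

lemma nsmul_subgroupH2 {G : Type u} [Group G] [TopologicalSpace G] [IsTopologicalGroup G]
    (U : Subgroup G) (n : ℕ) (x : SubgroupH2 (ZMod n) U) : n • x = 0 := by
  obtain ⟨f, rfl⟩ := QuotientAddGroup.mk_surjective x
  rw [← QuotientAddGroup.mk_nsmul, show n • f = 0 from ?_, QuotientAddGroup.mk_zero]
  refine Subtype.ext (LocallyConstant.ext fun y => ?_)
  change n • f.1 y = 0
  simp

/-- Every element of the direct limit comes from some `H²(U, ℤ/p^m)^*`, which `p^m` annihilates. -/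
lemma exists_pow_nsmul_dualizingModule {G : Type u} [Group G] [TopologicalSpace G]
    [IsTopologicalGroup G] [CompactSpace G] (p : ℕ) (x : DualizingModule G p) :
    ∃ k, p ^ k • x = 0 := by
  classical
  have : Nonempty (OpenNormalSubgroup G) :=
    ⟨⟨⟨⊤, isOpen_univ⟩, inferInstanceAs (⊤ : Subgroup G).Normal⟩⟩
  have : Nonempty (DualizingIndex G) := this.map fun U => (0, OrderDual.toDual U)
  induction x using AddCommGroup.DirectLimit.induction_on with
  | ih i φ =>
    refine ⟨i.1, ?_⟩
    rw [← map_nsmul, show p ^ i.1 • φ = 0 from ?_, map_zero]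
    refine AddMonoidHom.ext fun y => ?_
    rw [AddMonoidHom.nsmul_apply, ← map_nsmul, nsmul_subgroupH2, map_zero]
    rfl

lemma exists_card_dualizingInvariants {G : Type u} [Group G] [TopologicalSpace G]
    [IsTopologicalGroup G] [CompactSpace G] (p : ℕ) [Fact p.Prime]
    (h : Nat.card (dualizingInvariants G p) ≠ 0) :
    ∃ k, Nat.card (dualizingInvariants G p) = p ^ k := by
  have := Nat.finite_of_card_ne_zero h
  have hp : IsPGroup p (Multiplicative (dualizingInvariants G p)) := fun x => by
    obtain ⟨k, hk⟩ := exists_pow_nsmul_dualizingModule p x.toAdd.1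
    exact ⟨k, Subtype.ext hk⟩
  exact (IsPGroup.iff_card (G := Multiplicative (dualizingInvariants G p))).1 hp

lemma isPGroup_zmod {p q k : ℕ} (hq : q = p ^ k) : IsPGroup p (Multiplicative (ZMod q)) := fun x =>
  ⟨k, by
    subst hq
    change Multiplicative.ofAdd (p ^ k • x.toAdd) = 1
    simp⟩

/-! ### Isotropic subspaces and classes inflated from a free quotient -/

/-- A totally isotropic subspace for a nondegenerate form has at most half the dimension. -/
lemma two_mul_finrank_le_of_isotropic {K V L : Type*} [Field K] [AddCommGroup V] [Module K V]
    [Module.Finite K V] [AddCommGroup L] [Module K L] (hL : Module.finrank K L = 1)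
    {B : V →ₗ[K] V →ₗ[K] L} (hB : B.SeparatingLeft) (W : Submodule K V)
    (hW : ∀ a ∈ W, ∀ b ∈ W, B a b = 0) :
    2 * Module.finrank K W ≤ Module.finrank K V := by
  have : Module.Finite K L := Module.finite_of_finrank_eq_succ hL
  let e : L ≃ₗ[K] K := LinearEquiv.ofFinrankEq L K (by rw [hL, Module.finrank_self])
  -- Isotropy sends `a ∈ W` to a functional `B a` vanishing on `W`; left separation makes this
  -- injective, and the annihilator has dimension `dim V - dim W`.
  let T : W →ₗ[K] W.dualAnnihilator :=
    ((B.compr₂ e.toLinearMap).comp W.subtype).codRestrict _ fun a =>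
      (Submodule.mem_dualAnnihilator _).2 fun b hb => by
        change e (B a b) = 0
        rw [hW a a.2 b hb, map_zero]
  have hT : Function.Injective T := by
    refine (injective_iff_map_eq_zero T).2 fun a ha => Subtype.ext (hB a fun b => ?_)
    exact e.map_eq_zero_iff.1 (LinearMap.congr_fun (congrArg Subtype.val ha) b)
  have h1 := LinearMap.finrank_le_finrank_of_injective hT
  have h2 := Subspace.finrank_add_finrank_dualAnnihilator_eq W
  omega

/-- The cup product commutes with inflation already on cochains, so the class is inflated from
`H²(F, R) = 0`. -/
lemma IsFreeProP.cup_inflation_eq_zero {F : Type u} [Group F] [TopologicalSpace F]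
    [IsTopologicalGroup F] [CompactSpace F] [TotallyDisconnectedSpace F] {X : Type v} {ι : X → F}
    {p : ℕ} (hF : IsFreeProP p F ι) {R : Type} [CommRing R] [Finite R]
    (hR : IsPGroup p (Multiplicative R))
    {G : Type w} [Group G] [TopologicalSpace G] [IsTopologicalGroup G] (π : G →ₜ* F)
    (a b : H1 F R) : cup G R (inflation R π a) (inflation R π b) = 0 := by
  -- The discrete topology serves only to topologize the central extension.
  let : TopologicalSpace R := ⊥
  have : DiscreteTopology R := ⟨rfl⟩
  exact hF.mk_comap_eq_zero hR π ⟨_, cupCochain_mem a b⟩ _ fun _ _ => rfl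

lemma IsFreeProP.bockstein_inflation_eq_zero {F : Type u} [Group F] [TopologicalSpace F]
    [IsTopologicalGroup F] [CompactSpace F] [TotallyDisconnectedSpace F] {X : Type v} {ι : X → F}
    {p : ℕ} (hF : IsFreeProP p F ι) {q : ℕ} [NeZero q]
    (hq : IsPGroup p (Multiplicative (ZMod q)))
    {G : Type w} [Group G] [TopologicalSpace G] [IsTopologicalGroup G] (π : G →ₜ* F)
    (a : H1 F (ZMod q)) : bockstein G q (inflation (ZMod q) π a) = 0 := by
  let : TopologicalSpace (ZMod q) := ⊥
  have : DiscreteTopology (ZMod q) := ⟨rfl⟩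
  refine hF.mk_comap_eq_zero hq π ⟨_, bocksteinCochain_mem a⟩ _ fun x y => ?_
  change (((((a.1 (π x)).val : ℤ) - ((a.1 (π (x * y))).val : ℤ) + ((a.1 (π y)).val : ℤ)) / (q : ℤ)
    : ℤ) : ZMod q) = _
  rw [map_mul]
  rfl

end Demushkin

end

theorem proposition2p1 {p : ℕ} [Fact p.Prime] {n q : ℕ} [NeZero q]
    {G : Type*} [Group G] [TopologicalSpace G] [IsTopologicalGroup G] [CompactSpace G]
    [TotallyDisconnectedSpace G]
    {F : Type*} [Group F] [TopologicalSpace F] [IsTopologicalGroup F] [CompactSpace F]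
    [TotallyDisconnectedSpace F] {X : Type*}
    (hG : Demushkin.IsDemushkin p G) (hrank : Demushkin.proPRank p G = n + 2)
    (hq : Nat.card (Demushkin.dualizingInvariants G p) = q) (hq2 : 2 < q)
    (ι : X → F) (hF : Demushkin.IsFreeProP p F ι) (π : G →ₜ* F) (hπ : Function.Surjective π) :
    Function.Injective (Demushkin.inflation (ZMod q) π) ∧
    LinearMap.range (Demushkin.inflation (ZMod q) π) ≤ LinearMap.ker (Demushkin.bockstein G q) ∧
    Module.Free (ZMod q) (LinearMap.range (Demushkin.inflation (ZMod q) π)) ∧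
    (∀ a ∈ LinearMap.range (Demushkin.inflation (ZMod q) π), ∀ b ∈ LinearMap.range (Demushkin.inflation (ZMod q) π),
      Demushkin.cup G (ZMod q) a b = 0) ∧
    Finite X ∧ (Nat.card X : ℚ) ≤ (n : ℚ) / 2 + 1 := by
  -- `Nat.card` of an infinite group is `0`, so `q ≠ 0` encodes finiteness of the invariants.
  have hqp : IsPGroup p (Multiplicative (ZMod q)) := by
    obtain ⟨k, hk⟩ := Demushkin.exists_card_dualizingInvariants (G := G) p (hq ▸ NeZero.ne q)
    exact Demushkin.isPGroup_zmod (hq.symm.trans hk)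
  have hpp : IsPGroup p (Multiplicative (ZMod p)) :=
    Demushkin.isPGroup_zmod (pow_one p).symm
  have hinj := Demushkin.inflation_injective (ZMod q) π hπ
  have hinjp := Demushkin.inflation_injective (ZMod p) π hπ
  have := hG.finite_H1
  let ep : Demushkin.H1 F (ZMod p) ≃ₗ[ZMod p] (X →₀ ZMod p) :=
    let : TopologicalSpace (ZMod p) := ⊥
    have : DiscreteTopology (ZMod p) := ⟨rfl⟩
    hF.h1Equiv hpp
  let eq : Demushkin.H1 F (ZMod q) ≃ₗ[ZMod q] (X →₀ ZMod q) :=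
    let : TopologicalSpace (ZMod q) := ⊥
    have : DiscreteTopology (ZMod q) := ⟨rfl⟩
    hF.h1Equiv hqp
  have hfinF : Module.Finite (ZMod p) (Demushkin.H1 F (ZMod p)) :=
    Module.Finite.of_injective _ hinjp
  have hfinX : Module.Finite (ZMod p) (X →₀ ZMod p) := Module.Finite.equiv ep
  -- `H¹(F, 𝔽_p)` embeds in the finite-dimensional `H¹(G, 𝔽_p)` and has a basis indexed by `X`.
  have hX : Finite X := Module.Finite.finite_basis (Finsupp.basisSingleOne (R := ZMod p) (ι := X))
  refine ⟨hinj, ?_, ?_, ?_, hX, ?_⟩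
  · rintro _ ⟨a, rfl⟩
    exact hF.bockstein_inflation_eq_zero hqp π a
  · exact Module.Free.of_equiv (eq.symm.trans (LinearEquiv.ofInjective _ hinj))
  · rintro _ ⟨a, rfl⟩ _ ⟨b, rfl⟩
    exact hF.cup_inflation_eq_zero hqp π a b
  -- The coefficients are `ℤ/p` here rather than `ℤ/q`: this is where nondegeneracy and `dim H² = 1`
  -- are given.
  · have h := Demushkin.two_mul_finrank_le_of_isotropic hG.finrank_H2 hG.nondegenerate.1
      (LinearMap.range (Demushkin.inflation (ZMod p) π)) (by
        rintro _ ⟨a, rfl⟩ _ ⟨b, rfl⟩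
        exact hF.cup_inflation_eq_zero hpp π a b)
    have hcard : Module.finrank (ZMod p) (X →₀ ZMod p) = Nat.card X :=
      Module.finrank_eq_nat_card_basis Finsupp.basisSingleOne
    rw [LinearMap.finrank_range_of_inj hinjp, ep.finrank_eq, hcard,
      show Module.finrank (ZMod p) (Demushkin.H1 G (ZMod p)) = n + 2 from hrank] at h
    have h' : (2 : ℚ) * Nat.card X ≤ n + 2 := by exact_mod_cast h
    linarith
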